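/- **Setting.** A bandit game with $K$ arms and $T$ rounds. Before the game, an oblivious adversary, who knows the (possibly randomized) algorithm, fixes loss vectors $\boldsymbol\ell_1,\dots,\boldsymbol\ell_T\in[0,1]^K$. In each round $t$ the algorithm chooses an arm $I_t$, based on its internal randomness and on its past observations, and then observes its own loss $\ell_t(I_t)$ and the anchor point $a_t=\min_i \ell_t(i)$. Its expected regret is $\mathbb{E}\big[\sum_{t=1}^T \ell_t(I_t)\big]-\min_{i}\sum_{t=1}^T\ell_t(i)$, the expectation being over its internal randomness. For a simple graph on the $K$ arms with Laplacian matrix $L$ (degrees on the diagonal, $-1$ for adjacent pairs, $0$ elsewhere), let $\lambda_2(L)$ be the second-smallest eigenvalue of $L$, counted with multiplicity. **Theorem.** There are universal constants $c_1,c_2,c>0$ such that the following holds for all $\lambda\in(0,1]$ and all $C>0$, all sufficiently large $K$ (depending only on $\lambda$), all sufficiently large $T$ (depending only on $\lambda$ and $C$), and every randomized algorithm. There exist a simple graph on $K$ nodes whose Laplacian $L$ satisfies $\lambda_2(L)\in[c_1\lambda,c_2\lambda]$, and losses $\boldsymbol\ell_1,\dots,\boldsymbol\ell_T\in[0,1]^K$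 with $\boldsymbol\ell_t^\top L\,\boldsymbol\ell_t\le C^2$ for all $t=1,\dots,T$, such that the expected regret of the algorithm is at least $$c\,\min\Big\{\sqrt K,\ \frac{C}{\sqrt{\lambda_2(L)}}\Big\}\sqrt T .$$ -/

import Mathlib

open MeasureTheory

noncomputable section

namespace SmoothBandit

open Classical in
/-- The Laplacian matrix of a simple graph on `K` nodes. -/
def laplacian {K : ℕ} (G : SimpleGraph (Fin K)) : Matrix (Fin K) (Fin K) ℝ :=
  G.lapMatrix ℝ

theorem laplacian_isHermitian {K : ℕ} (G : SimpleGraph (Fin K)) :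
    (laplacian G).IsHermitian := by
  classical
  exact G.isHermitian_lapMatrix ℝ

/-- The second-smallest eigenvalue (counted with multiplicity) of the Laplacian. Mathlib lists
the eigenvalues of a Hermitian matrix in decreasing order, so this is the entry of index `K - 2`.
For fewer than two nodes the value is set to `0`. -/
def lambda2 {K : ℕ} (G : SimpleGraph (Fin K)) : ℝ :=
  if h : 2 ≤ K then
    (laplacian_isHermitian G).eigenvalues₀
      ⟨Fintype.card (Fin K) - 2, by rw [Fintype.card_fin]; omega⟩
  else 0

/-- What the learner has recorded about one round: the arm it chose, the loss of that arm, and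
the anchor point revealed at the end of the round. -/
structure Observation (K : ℕ) where
  arm : Fin K
  loss : ℝ
  anchor : ℝ

/-- A randomized bandit algorithm on `K` arms. Its internal randomness is a point `ω` of a
probability space; given the list of past observations (oldest first; its length is the number
of rounds already played) and `ω`, it chooses the next arm. -/
structure Algorithm (Ω : Type*) [MeasurableSpace Ω] (K : ℕ) where
  choose : List (Observation K) → Ω → Fin K
  measurable_choose : ∀ h, Measurable (choose h)

variable {Ω : Type*} [MeasurableSpace Ω] {K : ℕ}

/-- The observations made in the first `t` rounds against the losses `ℓ`. The anchor point of a
round is the smallest loss of that round. -/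
def Algorithm.history (A : Algorithm Ω K) (ℓ : ℕ → Fin K → ℝ) (ω : Ω) :
    ℕ → List (Observation K)
  | 0 => []
  | t + 1 =>
    A.history ℓ ω t ++
      [{ arm := A.choose (A.history ℓ ω t) ω
         loss := ℓ t (A.choose (A.history ℓ ω t) ω)
         anchor := ⨅ i, ℓ t i }]

/-- The arm chosen in round `t` (rounds are numbered `0, 1, …`). -/
def Algorithm.arm (A : Algorithm Ω K) (ℓ : ℕ → Fin K → ℝ) (t : ℕ) (ω : Ω) : Fin K :=
  A.choose (A.history ℓ ω t) ω

/-- The expected regret after `T` rounds; the expectation is over the algorithm's randomness. -/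
def Algorithm.expectedRegret (A : Algorithm Ω K) (μ : Measure Ω) (ℓ : ℕ → Fin K → ℝ)
    (T : ℕ) : ℝ :=
  (∫ ω, ∑ t ∈ Finset.range T, ℓ t (A.arm ℓ t ω) ∂μ) - ⨅ i, ∑ t ∈ Finset.range T, ℓ t i

end SmoothBandit

end

/-!
The lower bound combines the usual needle-in-a-haystack argument for bandits with losses that are
strongly correlated across the arms.

*Losses.* In every round a fair coin `Z` decides the loss of almost all arms at once: it is `σ` or
`0`. Only two arms may deviate. The arm `d` has the opposite loss, so that some arm always has loss
`0` and the anchor point carries no information; the best arm `i`, taken from a set of `m` arms,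
has its loss reset to `0` with probability `2 ε` (`hardBit`, `hardWeight`). Since the learner sees
the loss of one arm per round only, it cannot notice the correlation. It sees fair coin flips,
except that those of `i` have bias `ε`, so finding `i` takes about `ε⁻²` plays of `i` for each of
the `m` candidates. With `ε` of order `√(m / T)` this forces regret of order `σ √(m T)`
(`Algorithm.sum_sum_regret_ge`). The law of the observations is a product over the rounds
(`Algorithm.sum_obsBit`), its relative entropy to fair coin flips is at most `4 ε ^ 2` times the
expected number of plays of `i` (`Algorithm.entropy_le`), and entropy controls the change of
expectations (`sum_density_le`). All of this is done for fixed internal randomness `ω` and with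
finite sums; integrating over `ω` and exchanging the two averages yields one bad loss sequence
(`Algorithm.exists_regret_ge`).

*Graph.* A double star: a root, many leaves at the root, and one further neighbour of the root that
carries `s` leaves, with `s` about `1 / lam`. The second branch is joined to the rest by one edge,
so its indicator shows that `lambda2` is at most of order `1 / s`, and a Poincaré inequality shows
that it is at least of that order. The arms that deviate from `Z` are leaves at the root, so the
energy of the losses is at most `2 σ ^ 2`, however many candidates `m` there are.

*Parameters.* `σ = min 1 (C / √2)` makes the energy at most `C ^ 2`, and
`m = min (K - s - 3) ⌈max 2 (C ^ 2) / lam⌉` makes `σ √m` at least of order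
`min √K (C / √lambda2)`. This `m` is bounded in terms of `lam` and `C` alone, and therefore so is
the number of rounds that the argument requires.
-/

namespace SmoothBandit

/-! ### Product weights and relative entropy on finite sets -/

theorem sum_prod_weight {S : Type*} [Fintype S] {T : ℕ} (w : Fin T → S → ℝ) :
    ∑ e : Fin T → S, ∏ t, w t (e t) = ∏ t, ∑ s, w t s := by
  classical
  rw [Finset.prod_univ_sum, Fintype.piFinset_univ]

/-- Resampling one coordinate of a product distribution does not change expectations. -/
theorem sum_prod_weight_update {S : Type*} [Fintype S] {T : ℕ} (w : S → ℝ) (hw : ∑ s, w s = 1)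
    (t : Fin T) (F : (Fin T → S) → ℝ) :
    ∑ e : Fin T → S, (∏ u, w (e u)) * F e =
      ∑ e : Fin T → S, (∏ u, w (e u)) * ∑ s, w s * F (Function.update e t s) := by
  classical
  have key : ∀ (e : Fin T → S) (s : S),
      (∏ u, w (e u)) * w s = (∏ u, w (Function.update e t s u)) * w (e t) := by
    intro e s
    have h1 := Finset.mul_prod_erase Finset.univ (fun u => w (e u)) (Finset.mem_univ t)
    have h2 := Finset.mul_prod_erase Finset.univ (fun u => w (Function.update e t s u))
      (Finset.mem_univ t)
    have h3 : ∏ u ∈ Finset.univ.erase t, w (Function.update e t s u) =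
        ∏ u ∈ Finset.univ.erase t, w (e u) := by
      refine Finset.prod_congr rfl fun u hu => ?_
      rw [Function.update_of_ne (Finset.ne_of_mem_erase hu)]
    rw [← h1, ← h2, h3, Function.update_self]
    ring
  calc ∑ e : Fin T → S, (∏ u, w (e u)) * F e
      = ∑ p : (Fin T → S) × S, (∏ u, w (p.1 u)) * w p.2 * F p.1 := by
        rw [Fintype.sum_prod_type]
        refine Finset.sum_congr rfl fun e _ => ?_
        simp only
        rw [← Finset.sum_mul, ← Finset.mul_sum, hw, mul_one]
    _ = ∑ p : (Fin T → S) × S, (∏ u, w (p.1 u)) * w p.2 * F (Function.update p.1 t p.2) := by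
        refine Finset.sum_nbij' (fun p => (Function.update p.1 t p.2, p.1 t))
          (fun p => (Function.update p.1 t p.2, p.1 t)) (by simp) (by simp) (by simp) (by simp) ?_
        rintro ⟨e, s⟩ -
        simp only [Function.update_idem, Function.update_eq_self]
        rw [key e s]
    _ = _ := by
        rw [Fintype.sum_prod_type]
        refine Finset.sum_congr rfl fun e _ => ?_
        rw [Finset.mul_sum]
        refine Finset.sum_congr rfl fun s _ => ?_
        ring

/-- Change of measure: an observable with values in `[0, B]` has under the density `L` an
expectation that exceeds the original one by at most `2 B` times the square root of the relative
entropy. The Hellinger distance is the intermediary between total variation and entropy. -/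
theorem sum_density_le {X : Type*} [Fintype X] (p L N : X → ℝ) (B : ℝ)
    (hp : ∀ x, 0 ≤ p x) (hp1 : ∑ x, p x = 1) (hL : ∀ x, 0 < L x) (hL1 : ∑ x, p x * L x = 1)
    (hN : ∀ x, 0 ≤ N x) (hNB : ∀ x, N x ≤ B) :
    ∑ x, p x * L x * N x ≤
      ∑ x, p x * N x + B * (2 * √(∑ x, p x * (-Real.log (L x)))) := by
  have hne : Nonempty X := by
    by_contra h
    rw [not_nonempty_iff] at h
    simp at hp1
  have hB : 0 ≤ B := (hN hne.some).trans (hNB _)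
  set H := ∑ x, p x * (-Real.log (L x)) with hH
  have hell : ∑ x, p x * (√(L x) - 1) ^ 2 ≤ H := by
    have h1 : ∀ x, p x * (√(L x) - 1) ^ 2 ≤ p x * L x - p x + p x * (-Real.log (L x)) := by
      intro x
      have hs : 0 < √(L x) := Real.sqrt_pos.2 (hL x)
      have h2 := Real.log_le_sub_one_of_pos hs
      rw [Real.log_sqrt (hL x).le] at h2
      have h3 := Real.sq_sqrt (hL x).le
      have : (√(L x) - 1) ^ 2 ≤ L x - 1 + -Real.log (L x) := by nlinarith
      nlinarith [mul_le_mul_of_nonneg_left this (hp x)]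
    calc _ ≤ ∑ x, (p x * L x - p x + p x * (-Real.log (L x))) :=
          Finset.sum_le_sum fun x _ => h1 x
      _ = H := by rw [Finset.sum_add_distrib, Finset.sum_sub_distrib, hL1, hp1]; ring
  have hell' : ∑ x, p x * (√(L x) + 1) ^ 2 ≤ 4 := by
    have h1 : ∀ x, p x * (√(L x) + 1) ^ 2 ≤ 2 * (p x * L x) + 2 * p x := by
      intro x
      have h3 := Real.sq_sqrt (hL x).le
      have : (√(L x) + 1) ^ 2 ≤ 2 * L x + 2 := by nlinarith [sq_nonneg (√(L x) - 1)]
      nlinarith [mul_le_mul_of_nonneg_left this (hp x)]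
    calc _ ≤ ∑ x, (2 * (p x * L x) + 2 * p x) := Finset.sum_le_sum fun x _ => h1 x
      _ = 4 := by rw [Finset.sum_add_distrib, ← Finset.mul_sum, ← Finset.mul_sum, hL1, hp1]; ring
  have hH0 : 0 ≤ H := le_trans (Finset.sum_nonneg fun x _ => mul_nonneg (hp x) (sq_nonneg _)) hell
  have tv : ∑ x, p x * |L x - 1| ≤ 2 * √H := by
    have cs := Finset.sum_mul_sq_le_sq_mul_sq Finset.univ
      (fun x => √(p x) * |√(L x) - 1|) (fun x => √(p x) * (√(L x) + 1))
    have e1 : ∀ x, √(p x) * |√(L x) - 1| * (√(p x) * (√(L x) + 1)) = p x * |L x - 1| := by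
      intro x
      have h3 := Real.sq_sqrt (hL x).le
      have h4 := Real.mul_self_sqrt (hp x)
      have h5 : |L x - 1| = |√(L x) - 1| * (√(L x) + 1) := by
        rw [show L x - 1 = (√(L x) - 1) * (√(L x) + 1) by nlinarith, abs_mul,
          abs_of_nonneg (show 0 ≤ √(L x) + 1 by positivity)]
      rw [h5]
      linear_combination |√(L x) - 1| * (√(L x) + 1) * h4
    simp only [e1, mul_pow, sq_abs, Real.sq_sqrt (hp _)] at cs
    have h6 : (∑ x, p x * |L x - 1|) ^ 2 ≤ (2 * √H) ^ 2 := by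
      rw [mul_pow, Real.sq_sqrt hH0]
      refine cs.trans ?_
      have := mul_le_mul hell hell' (Finset.sum_nonneg fun x _ =>
        mul_nonneg (hp x) (sq_nonneg _)) hH0
      linarith
    exact le_of_sq_le_sq h6 (by positivity)
  have : ∑ x, p x * L x * N x - ∑ x, p x * N x ≤ B * ∑ x, p x * |L x - 1| := by
    rw [← Finset.sum_sub_distrib, Finset.mul_sum]
    refine Finset.sum_le_sum fun x _ => ?_
    have h1 : (L x - 1) * N x ≤ |L x - 1| * B :=
      (mul_le_mul_of_nonneg_right (le_abs_self _) (hN x)).trans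
        (mul_le_mul_of_nonneg_left (hNB x) (abs_nonneg _))
    nlinarith [mul_le_mul_of_nonneg_left h1 (hp x)]
  have := mul_le_mul_of_nonneg_left tv hB
  linarith

/-! ### The observations of a deterministic learner in a random environment -/

/-- Extension of a finite sequence to all of `ℕ` by a default value. -/
noncomputable def extend {S : Type*} [Inhabited S] {T : ℕ} (e : Fin T → S) (t : ℕ) : S :=
  if h : t < T then e ⟨t, h⟩ else default

theorem extend_apply {S : Type*} [Inhabited S] {T : ℕ} (e : Fin T → S) (t : Fin T) :
    extend e t = e t := by
  simp [extend]

theorem extend_update_of_lt {S : Type*} [Inhabited S] {T : ℕ} (e : Fin T → S) (t : Fin T) (s : S)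
    {u : ℕ} (hu : u < t) : extend (Function.update e t s) u = extend e u := by
  have : u < T := hu.trans t.2
  have hne : (⟨u, this⟩ : Fin T) ≠ t := fun h => by simp [← h] at hu
  simp [extend, this, Function.update_of_ne hne]

variable {Ω : Type*} [MeasurableSpace Ω] {K : ℕ} {S : Type*}

/-- Losses with values in `{0, σ}`: the environment draws a state `e t` in round `t`, and the state
determines which arms incur the loss `σ`. -/
noncomputable def bitLoss (σ : ℝ) (bit : S → Fin K → Bool) (e : ℕ → S) (t : ℕ) (j : Fin K) : ℝ :=
  σ * if bit (e t) j then 1 else 0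

/-- The history of the learner if it is fed the sequence of bits `x`, scaled by `σ`, as losses,
irrespective of the arms it chooses, and the anchor points are all `0`. -/
noncomputable def Algorithm.simHistory (A : Algorithm Ω K) (ω : Ω) (σ : ℝ) (x : ℕ → Bool) :
    ℕ → List (Observation K)
  | 0 => []
  | t + 1 =>
    A.simHistory ω σ x t ++
      [{ arm := A.choose (A.simHistory ω σ x t) ω
         loss := σ * if x t then 1 else 0
         anchor := 0 }]

/-- The arm the learner chooses in round `t` if it is fed the sequence of bits `x`. -/
noncomputable def Algorithm.simArm (A : Algorithm Ω K) (ω : Ω) (σ : ℝ) (x : ℕ → Bool) (t : ℕ) :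
    Fin K :=
  A.choose (A.simHistory ω σ x t) ω

/-- The bit the learner observes in round `t` against the losses `bitLoss σ bit e`. -/
noncomputable def Algorithm.obsBit (A : Algorithm Ω K) (ω : Ω) (σ : ℝ) (bit : S → Fin K → Bool)
    (e : ℕ → S) (t : ℕ) : Bool :=
  bit (e t) (A.arm (bitLoss σ bit e) t ω)

theorem Algorithm.simHistory_congr (A : Algorithm Ω K) (ω : Ω) (σ : ℝ) {x y : ℕ → Bool} {t : ℕ}
    (h : ∀ u < t, x u = y u) : A.simHistory ω σ x t = A.simHistory ω σ y t := by
  induction t with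
  | zero => rfl
  | succ t ih =>
    rw [simHistory, simHistory, ih fun u hu => h u (hu.trans t.lt_succ_self), h t t.lt_succ_self]

theorem Algorithm.history_congr (A : Algorithm Ω K) (ω : Ω) {ℓ ℓ' : ℕ → Fin K → ℝ} {t : ℕ}
    (h : ∀ u < t, ℓ u = ℓ' u) : A.history ℓ ω t = A.history ℓ' ω t := by
  induction t with
  | zero => rfl
  | succ t ih =>
    rw [history, history, ih fun u hu => h u (hu.trans t.lt_succ_self), h t t.lt_succ_self]

/-- If in every state some arm has loss `0`, then the anchor points carry no information. -/
theorem iInf_bitLoss {σ : ℝ} (hσ : 0 ≤ σ) {bit : S → Fin K → Bool}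
    (hbit : ∀ s, ∃ j, bit s j = false) (e : ℕ → S) (t : ℕ) : ⨅ j, bitLoss σ bit e t j = 0 := by
  obtain ⟨j, hj⟩ := hbit (e t)
  have h0 : ∀ j, 0 ≤ bitLoss σ bit e t j := fun j =>
    mul_nonneg hσ (by split_ifs <;> norm_num)
  have : Nonempty (Fin K) := ⟨j⟩
  refine le_antisymm ?_ (le_ciInf h0)
  refine (ciInf_le ⟨0, by rintro _ ⟨j, rfl⟩; exact h0 j⟩ j).trans ?_
  simp [bitLoss, hj]

theorem Algorithm.history_bitLoss (A : Algorithm Ω K) (ω : Ω) {σ : ℝ} (hσ : 0 ≤ σ)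
    {bit : S → Fin K → Bool} (hbit : ∀ s, ∃ j, bit s j = false) (e : ℕ → S) (t : ℕ) :
    A.history (bitLoss σ bit e) ω t = A.simHistory ω σ (A.obsBit ω σ bit e) t := by
  induction t with
  | zero => rfl
  | succ t ih =>
    rw [history, simHistory, ← ih, iInf_bitLoss hσ hbit]
    rfl

theorem Algorithm.arm_bitLoss (A : Algorithm Ω K) (ω : Ω) {σ : ℝ} (hσ : 0 ≤ σ)
    {bit : S → Fin K → Bool} (hbit : ∀ s, ∃ j, bit s j = false) (e : ℕ → S) (t : ℕ) :
    A.arm (bitLoss σ bit e) t ω = A.simArm ω σ (A.obsBit ω σ bit e) t := by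
  rw [arm, A.history_bitLoss ω hσ hbit, simArm]

/-- The learner observes the bits `x` if and only if, in every round, the state produces the bit
`x t` for the arm that the learner chooses after being fed `x`. -/
theorem Algorithm.obsBit_eq_iff (A : Algorithm Ω K) (ω : Ω) {σ : ℝ} (hσ : 0 ≤ σ)
    {bit : S → Fin K → Bool} (hbit : ∀ s, ∃ j, bit s j = false) (e : ℕ → S) (x : ℕ → Bool)
    (T : ℕ) : (∀ t < T, A.obsBit ω σ bit e t = x t) ↔
      ∀ t < T, bit (e t) (A.simArm ω σ x t) = x t := by
  have step : ∀ t, (∀ u < t, A.obsBit ω σ bit e u = x u) →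
      A.obsBit ω σ bit e t = bit (e t) (A.simArm ω σ x t) := by
    intro t ht
    rw [obsBit, A.arm_bitLoss ω hσ hbit, simArm, simArm, A.simHistory_congr ω σ ht]
  constructor
  · intro h t ht
    rw [← step t fun u hu => h u (hu.trans ht), h t ht]
  · intro h t
    induction t using Nat.strong_induction_on with
    | _ t ih =>
      intro ht
      rw [step t fun u hu => ih u hu (hu.trans ht), h t ht]

/-- The law of the observed bits: by the chain rule it is the product of the marginal laws of the
arms chosen along the way. -/
theorem Algorithm.sum_obsBit [Fintype S] [Inhabited S] (A : Algorithm Ω K) (ω : Ω)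
    {σ : ℝ} (hσ : 0 ≤ σ)
    {bit : S → Fin K → Bool} (hbit : ∀ s, ∃ j, bit s j = false) (w : S → ℝ) {T : ℕ}
    (φ : (Fin T → Bool) → ℝ) :
    ∑ e : Fin T → S, (∏ t, w (e t)) * φ (fun t => A.obsBit ω σ bit (extend e) t) =
      ∑ x : Fin T → Bool, (∏ t : Fin T, ∑ s,
        if bit s (A.simArm ω σ (extend x) t) = x t then w s else 0) * φ x := by
  classical
  have h1 : ∀ e : Fin T → S, (∏ t, w (e t)) * φ (fun t => A.obsBit ω σ bit (extend e) t) =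
      ∑ x : Fin T → Bool, (∏ t : Fin T,
        if bit (e t) (A.simArm ω σ (extend x) t) = x t then w (e t) else 0) * φ x := by
    intro e
    rw [Finset.sum_eq_single (fun t : Fin T => A.obsBit ω σ bit (extend e) t)]
    · congr 1
      refine Finset.prod_congr rfl fun t _ => ?_
      rw [if_pos]
      have := (A.obsBit_eq_iff ω hσ hbit (extend e)
        (extend fun t : Fin T => A.obsBit ω σ bit (extend e) t) T).1
        (fun t ht => (extend_apply (fun t : Fin T => A.obsBit ω σ bit (extend e) t) ⟨t, ht⟩).symm)
        t t.2
      rwa [extend_apply, extend_apply] at this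
    · intro x _ hx
      have : ∃ t : Fin T, ¬ bit (e t) (A.simArm ω σ (extend x) t) = x t := by
        by_contra! hcon
        apply hx
        funext t
        have := (A.obsBit_eq_iff ω hσ hbit (extend e) (extend x) T).2 (fun t ht => by
          have := hcon ⟨t, ht⟩
          rwa [← extend_apply e, ← extend_apply x] at this) t t.2
        rw [this, extend_apply]
      obtain ⟨t, ht⟩ := this
      rw [Finset.prod_eq_zero (Finset.mem_univ t) (if_neg ht), zero_mul]
    · simp
  simp only [h1]
  rw [Finset.sum_comm]
  refine Finset.sum_congr rfl fun x _ => ?_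
  rw [← Finset.sum_mul, ← sum_prod_weight (fun (t : Fin T) s =>
    if bit s (A.simArm ω σ (extend x) t) = x t then w s else 0)]

/-- The arm chosen in round `t` is independent of the state of that round. -/
theorem Algorithm.arm_extend_update [Inhabited S] (A : Algorithm Ω K) (ω : Ω) (σ : ℝ)
    (bit : S → Fin K → Bool) {T : ℕ} (e : Fin T → S) (t : Fin T) (s : S) :
    A.arm (bitLoss σ bit (extend (Function.update e t s))) t ω =
      A.arm (bitLoss σ bit (extend e)) t ω := by
  rw [arm, arm, A.history_congr ω fun u hu => ?_]
  funext j
  rw [bitLoss, bitLoss, extend_update_of_lt e t s hu]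

theorem Algorithm.simArm_extend_update (A : Algorithm Ω K) (ω : Ω) (σ : ℝ) {T : ℕ}
    (x : Fin T → Bool) (t : Fin T) (b : Bool) :
    A.simArm ω σ (extend (Function.update x t b)) t = A.simArm ω σ (extend x) t := by
  rw [simArm, simArm, A.simHistory_congr ω σ fun u hu => extend_update_of_lt x t b hu]

/-! ### The hard environments -/

/-- The random bits of the environment in which `i` is the best arm. A state is a pair `(Z, B)`;
all arms have the bit `Z`, except that the bit of the arm `d` is negated, so that in every state
some arm has loss `0`, and that the bit of `i` is reset to `0` if `B` is `false`. -/
def hardBit (d i : Fin K) (s : Bool × Bool) (j : Fin K) : Bool :=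
  if j = d then !s.1 else if j = i then s.1 && s.2 else s.1

/-- The law of a state: `Z` is a fair coin, and independently `B` is `false` with
probability `2 ε`. -/
noncomputable def hardWeight (ε : ℝ) (s : Bool × Bool) : ℝ :=
  1 / 2 * if s.2 then 1 - 2 * ε else 2 * ε

theorem sum_hardWeight (ε : ℝ) : ∑ s, hardWeight ε s = 1 := by
  simp [Fintype.sum_prod_type, hardWeight]

theorem hardWeight_pos {ε : ℝ} (h0 : 0 < ε) (h1 : 2 * ε < 1) (s : Bool × Bool) :
    0 < hardWeight ε s := by
  unfold hardWeight
  split_ifs <;> linarith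

theorem exists_hardBit_eq_false {d i h : Fin K} (hd : h ≠ d) (hi : h ≠ i) (s : Bool × Bool) :
    ∃ j, hardBit d i s j = false := by
  rcases s with ⟨_ | _, b⟩
  · exact ⟨h, by simp [hardBit, hd, hi]⟩
  · exact ⟨d, by simp [hardBit]⟩

/-- The likelihood ratio of one observed bit `b` with respect to a fair coin; `good` tells whether
the bit comes from the best arm. -/
noncomputable def bitRatio (ε : ℝ) (good b : Bool) : ℝ :=
  if good then (if b then 1 - 2 * ε else 1 + 2 * ε) else 1

/-- The marginal law of the bit of each arm `j`. The arm `d` is as fair a coin as any other. -/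
theorem sum_hardBit {d i : Fin K} (hid : i ≠ d) (ε : ℝ) (j : Fin K) (b : Bool) :
    (∑ s, if hardBit d i s j = b then hardWeight ε s else 0) =
      1 / 2 * bitRatio ε (decide (j = i)) b := by
  by_cases h1 : j = d
  · have h2 : ¬ d = i := fun h => hid h.symm
    subst h1
    cases b <;> simp [Fintype.sum_prod_type, hardBit, hardWeight, bitRatio, h2] <;> ring
  · by_cases h2 : j = i
    · subst h2
      cases b <;> simp [Fintype.sum_prod_type, hardBit, hardWeight, bitRatio, h1] <;> ring
    · cases b <;> simp [Fintype.sum_prod_type, hardBit, hardWeight, bitRatio, h1, h2] <;> ring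

theorem bitRatio_pos {ε : ℝ} (h0 : 0 ≤ ε) (h1 : 2 * ε < 1) (g b : Bool) : 0 < bitRatio ε g b := by
  unfold bitRatio
  split_ifs <;> linarith

/-- The relative entropy of a fair coin with respect to a coin of bias `ε` is `O(ε ^ 2)`. -/
theorem entropy_bitRatio_le {ε : ℝ} (h0 : 0 ≤ ε) (h1 : 8 * ε ^ 2 ≤ 1) :
    ∑ b, 1 / 2 * (-Real.log (bitRatio ε true b)) ≤ 4 * ε ^ 2 := by
  have h2 : 2 * ε < 1 := by nlinarith
  have h3 : 0 < 1 - 4 * ε ^ 2 := by nlinarith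
  have h4 := Real.one_sub_inv_le_log_of_pos h3
  have h5 : Real.log (1 - 4 * ε ^ 2) = Real.log (1 - 2 * ε) + Real.log (1 + 2 * ε) := by
    rw [← Real.log_mul (by linarith) (by linarith)]
    ring_nf
  have h6 : -(8 * ε ^ 2) ≤ 1 - (1 - 4 * ε ^ 2)⁻¹ := by
    have : (1 - 4 * ε ^ 2)⁻¹ ≤ 1 + 8 * ε ^ 2 := by
      rw [inv_le_iff_one_le_mul₀ h3]
      nlinarith [sq_nonneg ε]
    linarith
  simp only [Fintype.univ_bool, Finset.mem_singleton, Bool.true_eq_false, not_false_eq_true,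
    Finset.sum_insert, Finset.sum_singleton, bitRatio, if_true, Bool.false_eq_true, if_false]
  linarith

/-- The number of times that the learner chooses the arm `i` if it is fed the bits `x`. -/
noncomputable def Algorithm.simCount (A : Algorithm Ω K) (ω : Ω) (σ : ℝ) {T : ℕ}
    (x : Fin T → Bool) (i : Fin K) : ℝ :=
  ∑ t : Fin T, if A.simArm ω σ (extend x) t = i then 1 else 0

theorem Algorithm.simCount_nonneg (A : Algorithm Ω K) (ω : Ω) (σ : ℝ) {T : ℕ}
    (x : Fin T → Bool) (i : Fin K) : 0 ≤ A.simCount ω σ x i :=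
  Finset.sum_nonneg fun _ _ => by split_ifs <;> norm_num

theorem Algorithm.simCount_le (A : Algorithm Ω K) (ω : Ω) (σ : ℝ) {T : ℕ}
    (x : Fin T → Bool) (i : Fin K) : A.simCount ω σ x i ≤ T := by
  calc A.simCount ω σ x i ≤ ∑ _t : Fin T, (1 : ℝ) :=
        Finset.sum_le_sum fun _ _ => by split_ifs <;> norm_num
    _ = T := by simp

theorem Algorithm.sum_simCount_le (A : Algorithm Ω K) (ω : Ω) (σ : ℝ) {T : ℕ}
    (x : Fin T → Bool) (I : Finset (Fin K)) : ∑ i ∈ I, A.simCount ω σ x i ≤ T := by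
  unfold simCount
  rw [Finset.sum_comm]
  calc _ ≤ ∑ _t : Fin T, (1 : ℝ) :=
        Finset.sum_le_sum fun _ _ => by rw [Finset.sum_ite_eq]; split_ifs <;> norm_num
    _ = T := by simp

/-- The expected number of times that the learner chooses `i` if it is fed fair coin flips. -/
noncomputable def Algorithm.fairCount (A : Algorithm Ω K) (ω : Ω) (σ : ℝ) (T : ℕ) (i : Fin K) :
    ℝ :=
  ∑ x : Fin T → Bool, (∏ _t : Fin T, (1 / 2 : ℝ)) * A.simCount ω σ x i

theorem sum_fair (T : ℕ) : ∑ _x : Fin T → Bool, ∏ _t : Fin T, (1 / 2 : ℝ) = 1 := by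
  rw [sum_prod_weight (fun _ (_ : Bool) => (1 / 2 : ℝ))]
  simp

theorem Algorithm.sum_fairCount_le (A : Algorithm Ω K) (ω : Ω) (σ : ℝ) (T : ℕ)
    (I : Finset (Fin K)) : ∑ i ∈ I, A.fairCount ω σ T i ≤ T := by
  unfold fairCount
  rw [Finset.sum_comm]
  calc _ ≤ ∑ _x : Fin T → Bool, (∏ _t : Fin T, (1 / 2 : ℝ)) * T :=
        Finset.sum_le_sum fun x _ => by
          rw [← Finset.mul_sum]
          exact mul_le_mul_of_nonneg_left (A.sum_simCount_le ω σ x I) (by positivity)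
    _ = T := by rw [← Finset.sum_mul, sum_fair, one_mul]

/-- The entropy chain rule: information about `i` is gained only in rounds in which `i` is
chosen. -/
theorem Algorithm.entropy_le (A : Algorithm Ω K) (ω : Ω) (σ : ℝ) (T : ℕ) (i : Fin K) {ε : ℝ}
    (h0 : 0 ≤ ε) (h1 : 8 * ε ^ 2 ≤ 1) :
    ∑ x : Fin T → Bool, (∏ _t : Fin T, (1 / 2 : ℝ)) *
      (-Real.log (∏ t : Fin T, bitRatio ε (decide (A.simArm ω σ (extend x) t = i)) (x t))) ≤
    4 * ε ^ 2 * A.fairCount ω σ T i := by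
  have h2 : 2 * ε < 1 := by nlinarith
  have e1 : ∀ x : Fin T → Bool, (∏ _t : Fin T, (1 / 2 : ℝ)) *
      (-Real.log (∏ t : Fin T, bitRatio ε (decide (A.simArm ω σ (extend x) t = i)) (x t))) =
      ∑ t : Fin T, (∏ _t : Fin T, (1 / 2 : ℝ)) *
        (-Real.log (bitRatio ε (decide (A.simArm ω σ (extend x) t = i)) (x t))) := by
    intro x
    rw [Real.log_prod fun t _ => (bitRatio_pos h0 h2 _ _).ne', ← Finset.mul_sum,
      Finset.sum_neg_distrib]
  simp only [e1, fairCount, simCount, Finset.mul_sum]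
  rw [Finset.sum_comm, Finset.sum_comm (t := Finset.univ (α := Fin T))]
  refine Finset.sum_le_sum fun t _ => ?_
  -- the arm chosen in round `t` does not depend on the bit of that round, so average over the bit
  rw [sum_prod_weight_update (fun _ : Bool => (1 / 2 : ℝ)) (by simp) t]
  refine Finset.sum_le_sum fun x _ => ?_
  simp only [A.simArm_extend_update, Function.update_self]
  rw [mul_left_comm]
  refine mul_le_mul_of_nonneg_left ?_ (by positivity)
  by_cases hc : A.simArm ω σ (extend x) t = i
  · simpa [hc] using! entropy_bitRatio_le h0 h1
  · simp [hc, bitRatio]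

/-- In the environment of `i` the arm `i` is not chosen much more often than under fair coin
flips. -/
theorem Algorithm.sum_simCount_obsBit_le (A : Algorithm Ω K) (ω : Ω) {σ : ℝ} (hσ : 0 ≤ σ) (T : ℕ)
    {d i h : Fin K} (hd : h ≠ d) (hi : h ≠ i) (hid : i ≠ d) {ε : ℝ}
    (h0 : 0 ≤ ε) (h1 : 8 * ε ^ 2 ≤ 1) :
    ∑ e : Fin T → Bool × Bool, (∏ t, hardWeight ε (e t)) *
        A.simCount ω σ (fun t : Fin T => A.obsBit ω σ (hardBit d i) (extend e) t) i ≤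
      A.fairCount ω σ T i + T * (4 * ε * √(A.fairCount ω σ T i)) := by
  have h2 : 2 * ε < 1 := by nlinarith
  have hbit := exists_hardBit_eq_false hd hi
  have law : ∀ φ : (Fin T → Bool) → ℝ, ∑ e : Fin T → Bool × Bool, (∏ t, hardWeight ε (e t)) *
        φ (fun t : Fin T => A.obsBit ω σ (hardBit d i) (extend e) t) =
      ∑ x : Fin T → Bool, (∏ _t : Fin T, (1 / 2 : ℝ)) *
        (∏ t : Fin T, bitRatio ε (decide (A.simArm ω σ (extend x) t = i)) (x t)) * φ x := by
    intro φ
    rw [A.sum_obsBit ω hσ hbit (hardWeight ε) φ]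
    refine Finset.sum_congr rfl fun x _ => ?_
    simp only [sum_hardBit hid, Finset.prod_mul_distrib]
  have hL1 := law fun _ => 1
  simp only [mul_one] at hL1
  rw [sum_prod_weight (fun _ => hardWeight ε)] at hL1
  simp only [sum_hardWeight, Finset.prod_const_one] at hL1
  rw [law fun x => A.simCount ω σ x i]
  refine (sum_density_le _ _ _ (T : ℝ) (fun _ => by positivity) (sum_fair T)
    (fun x => Finset.prod_pos fun t _ => bitRatio_pos h0 h2 _ _) hL1.symm
    (fun x => A.simCount_nonneg ω σ x i) (fun x => A.simCount_le ω σ x i)).trans ?_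
  have h3 := Real.sqrt_le_sqrt (A.entropy_le ω σ T i h0 h1)
  rw [show 4 * ε ^ 2 * A.fairCount ω σ T i = (2 * ε) ^ 2 * A.fairCount ω σ T i by ring,
    Real.sqrt_mul (sq_nonneg _), Real.sqrt_sq (by linarith)] at h3
  have := mul_le_mul_of_nonneg_left h3 (Nat.cast_nonneg T : (0 : ℝ) ≤ T)
  unfold fairCount at *
  linarith

/-- In the environment of `i`, every round in which `i` is not chosen costs `σ ε` in expectation
compared with always playing `i`. -/
theorem Algorithm.sum_regret_eq (A : Algorithm Ω K) (ω : Ω) {σ : ℝ} (hσ : 0 ≤ σ) (T : ℕ)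
    {d i h : Fin K} (hd : h ≠ d) (hi : h ≠ i) (hid : i ≠ d) (ε : ℝ) :
    ∑ e : Fin T → Bool × Bool, (∏ t, hardWeight ε (e t)) *
      ∑ t ∈ Finset.range T, (bitLoss σ (hardBit d i) (extend e) t
        (A.arm (bitLoss σ (hardBit d i) (extend e)) t ω) -
        bitLoss σ (hardBit d i) (extend e) t i) =
    σ * ε * (T - ∑ e : Fin T → Bool × Bool, (∏ t, hardWeight ε (e t)) *
        A.simCount ω σ (fun t : Fin T => A.obsBit ω σ (hardBit d i) (extend e) t) i) := by
  have hbit := exists_hardBit_eq_false hd hi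
  have hmean : ∀ j, ∑ s, hardWeight ε s * (if hardBit d i s j then (1 : ℝ) else 0) =
      1 / 2 - if j = i then ε else 0 := by
    intro j
    have := sum_hardBit hid ε j true
    simp only [mul_ite, mul_one, mul_zero]
    rw [this]
    unfold bitRatio
    by_cases hj : j = i <;> simp [hj]
    ring
  have hone : ∑ e : Fin T → Bool × Bool, ∏ t, hardWeight ε (e t) = 1 := by
    rw [sum_prod_weight (fun _ => hardWeight ε)]
    simp [sum_hardWeight]
  have hcount : ∀ e : Fin T → Bool × Bool,
      A.simCount ω σ (fun t : Fin T => A.obsBit ω σ (hardBit d i) (extend e) t) i =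
      ∑ t : Fin T, if A.arm (bitLoss σ (hardBit d i) (extend e)) t ω = i then 1 else 0 := by
    intro e
    unfold simCount
    refine Finset.sum_congr rfl fun t _ => ?_
    rw [A.arm_bitLoss ω hσ hbit, simArm, simArm, A.simHistory_congr ω σ fun u hu => ?_]
    exact extend_apply (fun t : Fin T => A.obsBit ω σ (hardBit d i) (extend e) t)
      ⟨u, hu.trans t.2⟩
  have hT : (T : ℝ) = ∑ _t : Fin T, (1 : ℝ) := by simp
  simp only [hcount, Finset.sum_range, Finset.mul_sum]
  rw [Finset.sum_comm, Finset.sum_comm (s := Finset.univ (α := Fin T → Bool × Bool)), hT,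
    ← Finset.sum_sub_distrib, Finset.mul_sum]
  refine Finset.sum_congr rfl fun t _ => ?_
  rw [sum_prod_weight_update (hardWeight ε) (sum_hardWeight ε) t]
  simp only [A.arm_extend_update, bitLoss, extend_apply, Function.update_self]
  have hstate : ∀ j, ∑ s, hardWeight ε s * (σ * if hardBit d i s j then (1 : ℝ) else 0) =
      σ * (1 / 2 - if j = i then ε else 0) := by
    intro j
    rw [← hmean j, Finset.mul_sum]
    exact Finset.sum_congr rfl fun s _ => by ring
  simp only [mul_sub (hardWeight ε _), Finset.sum_sub_distrib, hstate, if_true]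
  conv_rhs => enter [2, 1]; rw [← hone]
  rw [← Finset.sum_sub_distrib, Finset.mul_sum]
  refine Finset.sum_congr rfl fun e _ => ?_
  split_ifs <;> ring

/-- Averaged over the best arm `i ∈ I` and over its environment, the regret of a learner with fixed
internal randomness is at least of order `√(m T)`, where `m` is the number of arms in `I`. -/
theorem Algorithm.sum_sum_regret_ge (A : Algorithm Ω K) (ω : Ω) {σ : ℝ} (hσ : 0 ≤ σ) {T : ℕ}
    {d h : Fin K} (hd : h ≠ d) (I : Finset (Fin K)) (hI : ∀ i ∈ I, h ≠ i ∧ i ≠ d)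
    (hI2 : 2 ≤ I.card) (hIT : I.card ≤ T) {ε : ℝ}
    (hε : ε = √((I.card : ℝ) / T) / 16) :
    (I.card : ℝ) * (σ * √((I.card : ℝ) * T) / 64) ≤
    ∑ i ∈ I, ∑ e : Fin T → Bool × Bool, (∏ t, hardWeight ε (e t)) *
      ∑ t ∈ Finset.range T, (bitLoss σ (hardBit d i) (extend e) t
        (A.arm (bitLoss σ (hardBit d i) (extend e)) t ω) -
        bitLoss σ (hardBit d i) (extend e) t i) := by
  set m : ℝ := (I.card : ℝ) with hm
  have hm2 : (2 : ℝ) ≤ m := by rw [hm]; exact_mod_cast hI2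
  have hmT : m ≤ T := by rw [hm]; exact_mod_cast hIT
  have hT : (0 : ℝ) < T := by linarith
  have hε0 : 0 ≤ ε := by rw [hε]; positivity
  have hε2 : 256 * ε ^ 2 * T = m := by
    rw [hε, div_pow, Real.sq_sqrt (by positivity)]
    field_simp
    norm_num
  have hε1 : 8 * ε ^ 2 ≤ 1 := by
    by_contra hcon
    push Not at hcon
    nlinarith [mul_lt_mul_of_pos_right hcon hT]
  have hεT : ε * T = √(m * T) / 16 := by
    rw [hε, div_mul_eq_mul_div]
    congr 1
    rw [← Real.sqrt_sq hT.le, ← Real.sqrt_mul (by positivity), Real.sqrt_sq hT.le]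
    congr 1
    field_simp
  have hr0 : 0 ≤ √(m * T) := Real.sqrt_nonneg _
  have cs : ∑ i ∈ I, √(A.fairCount ω σ T i) ≤ √(m * T) := by
    apply Real.le_sqrt_of_sq_le
    have h1 := sq_sum_le_card_mul_sum_sq (s := I) (f := fun i => √(A.fairCount ω σ T i))
    refine h1.trans ?_
    refine mul_le_mul_of_nonneg_left ?_ (by positivity)
    refine le_trans (le_of_eq ?_) (A.sum_fairCount_le ω σ T I)
    refine Finset.sum_congr rfl fun i _ => Real.sq_sqrt ?_
    exact Finset.sum_nonneg fun x _ => mul_nonneg (by positivity) (A.simCount_nonneg ω σ x i)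
  have main : ∀ i ∈ I, σ * ε * (T - (A.fairCount ω σ T i + T * (4 * ε * √(A.fairCount ω σ T i)))) ≤
      ∑ e : Fin T → Bool × Bool, (∏ t, hardWeight ε (e t)) *
      ∑ t ∈ Finset.range T, (bitLoss σ (hardBit d i) (extend e) t
        (A.arm (bitLoss σ (hardBit d i) (extend e)) t ω) -
        bitLoss σ (hardBit d i) (extend e) t i) := by
    intro i hi
    rw [A.sum_regret_eq ω hσ T hd (hI i hi).1 (hI i hi).2]
    refine mul_le_mul_of_nonneg_left ?_ (mul_nonneg hσ hε0)
    linarith [A.sum_simCount_obsBit_le ω hσ T hd (hI i hi).1 (hI i hi).2 hε0 hε1]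
  refine le_trans ?_ (Finset.sum_le_sum main)
  have hsum : ∑ i ∈ I, σ * ε * (T - (A.fairCount ω σ T i +
        T * (4 * ε * √(A.fairCount ω σ T i)))) =
      σ * ε * (m * T - (∑ i ∈ I, A.fairCount ω σ T i +
        T * (4 * ε * ∑ i ∈ I, √(A.fairCount ω σ T i)))) := by
    simp only [← Finset.mul_sum, Finset.sum_sub_distrib, Finset.sum_add_distrib, Finset.sum_const,
      nsmul_eq_mul, ← hm]
  rw [hsum]
  have h3 : T * (4 * ε * ∑ i ∈ I, √(A.fairCount ω σ T i)) ≤ m * T / 4 := by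
    calc T * (4 * ε * ∑ i ∈ I, √(A.fairCount ω σ T i))
        = 4 * (ε * T) * ∑ i ∈ I, √(A.fairCount ω σ T i) := by ring
      _ ≤ 4 * (ε * T) * √(m * T) := mul_le_mul_of_nonneg_left cs (by positivity)
      _ = √(m * T) ^ 2 / 4 := by rw [hεT]; ring
      _ = m * T / 4 := by rw [Real.sq_sqrt (by positivity)]
  have h4 := A.sum_fairCount_le ω σ T I
  have h5 : m * T / 4 ≤ m * T - (∑ i ∈ I, A.fairCount ω σ T i +
        T * (4 * ε * ∑ i ∈ I, √(A.fairCount ω σ T i))) := by nlinarith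
  calc m * (σ * √(m * T) / 64) = σ * ε * (m * T / 4) := by
        rw [show σ * ε * (m * T / 4) = σ * (ε * T) * (m / 4) by ring, hεT]; ring
    _ ≤ _ := mul_le_mul_of_nonneg_left h5 (mul_nonneg hσ hε0)

/-! ### The second-smallest eigenvalue of a Laplacian -/

/-- The Dirichlet energy of `f` on the graph `G`. -/
noncomputable def energy {K : ℕ} (G : SimpleGraph (Fin K)) (f : Fin K → ℝ) : ℝ :=
  f ⬝ᵥ (laplacian G).mulVec f

open Classical in
theorem energy_eq_sum {K : ℕ} (G : SimpleGraph (Fin K)) (f : Fin K → ℝ) :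
    energy G f = (∑ i, ∑ j, if G.Adj i j then (f i - f j) ^ 2 else 0) / 2 := by
  rw [energy, laplacian, ← SimpleGraph.lapMatrix_toLinearMap₂', Matrix.toLinearMap₂'_apply']

theorem energy_const_mul {K : ℕ} (G : SimpleGraph (Fin K)) (f : Fin K → ℝ) (a : ℝ) :
    energy G (fun i => a * f i) = a ^ 2 * energy G f := by
  classical
  simp only [energy_eq_sum, ← mul_sub, mul_pow, mul_div_assoc', Finset.mul_sum, mul_ite, mul_zero]

open Classical in
/-- The eigenvectors of the Laplacian diagonalize the energy: some orthonormal basis `b` of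
eigenvectors has two distinct elements `u`, `v`, with eigenvalues at most `lambda2 G` and equal to
`lambda2 G`, such that all elements other than `u` have eigenvalue at least `lambda2 G`. -/
theorem exists_eigenbasis {K : ℕ} (hK : 2 ≤ K) (G : SimpleGraph (Fin K)) :
    ∃ (b : OrthonormalBasis (Fin K) ℝ (EuclideanSpace ℝ (Fin K))) (ev : Fin K → ℝ)
      (u v : Fin K), u ≠ v ∧ ev u ≤ lambda2 G ∧ ev v = lambda2 G ∧
      (∀ i, i ≠ u → lambda2 G ≤ ev i) ∧
      ∀ f : EuclideanSpace ℝ (Fin K), energy G f = ∑ i, ev i * (inner ℝ (b i) f) ^ 2 := by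
  set hA := laplacian_isHermitian G
  set E : Fin (Fintype.card (Fin K)) ≃ Fin K := Fintype.equivOfCardEq (Fintype.card_fin _)
  have hc : Fintype.card (Fin K) = K := Fintype.card_fin K
  have hev : ∀ k, hA.eigenvalues (E k) = hA.eigenvalues₀ k := by
    intro k
    simp [Matrix.IsHermitian.eigenvalues, E]
  have hl : lambda2 G = hA.eigenvalues₀ ⟨Fintype.card (Fin K) - 2, by omega⟩ := by
    simp only [lambda2, hK, dif_pos]
  refine ⟨hA.eigenvectorBasis, hA.eigenvalues, E ⟨Fintype.card (Fin K) - 1, by omega⟩,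
    E ⟨Fintype.card (Fin K) - 2, by omega⟩, ?_, ?_, ?_, ?_, ?_⟩
  · intro h
    have := congrArg Fin.val (E.injective h)
    simp only at this
    omega
  · rw [hev, hl]
    exact hA.eigenvalues₀_antitone (by simp only [Fin.mk_le_mk]; omega)
  · rw [hev, hl]
  · intro i hi
    obtain ⟨k, rfl⟩ := E.surjective i
    rw [hev, hl]
    apply hA.eigenvalues₀_antitone
    have : (k : ℕ) ≠ Fintype.card (Fin K) - 1 := fun h => hi (congrArg E (Fin.ext h))
    have := k.2
    rw [Fin.le_def]
    simp only
    omega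
  · intro f
    have hL : ∀ i, inner ℝ (hA.eigenvectorBasis i) (WithLp.toLp 2 ((laplacian G).mulVec f)) =
        hA.eigenvalues i * inner ℝ (hA.eigenvectorBasis i) f := by
      intro i
      have h1 := hA.mulVec_eigenvectorBasis i
      simp only [EuclideanSpace.inner_eq_star_dotProduct, star_trivial]
      rw [dotProduct_comm, Matrix.dotProduct_mulVec, ← Matrix.mulVec_transpose]
      have h2 : (laplacian G).transpose = laplacian G := by
        have := hA.eq
        rwa [Matrix.conjTranspose_eq_transpose_of_trivial] at this
      rw [h2, h1, smul_dotProduct, smul_eq_mul, dotProduct_comm]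
    have h3 := hA.eigenvectorBasis.sum_inner_mul_inner f
      (WithLp.toLp 2 ((laplacian G).mulVec f))
    have h4 : inner ℝ f (WithLp.toLp 2 ((laplacian G).mulVec f)) = energy G f := by
      simp only [EuclideanSpace.inner_eq_star_dotProduct, star_trivial, energy]
      rw [dotProduct_comm]
    rw [← h4, ← h3]
    refine Finset.sum_congr rfl fun i _ => ?_
    rw [hL, real_inner_comm f]
    ring

/-- A Poincaré inequality bounds `lambda2` from below. -/
theorem le_lambda2 {K : ℕ} (hK : 2 ≤ K) (G : SimpleGraph (Fin K)) {c : ℝ}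
    (h : ∀ f : Fin K → ℝ, ∑ i, f i = 0 → c * ∑ i, f i ^ 2 ≤ energy G f) : c ≤ lambda2 G := by
  classical
  obtain ⟨b, ev, u, v, huv, hu, hv, -, hE⟩ := exists_eigenbasis hK G
  -- a combination `x • b u + y • b v` of mean zero
  obtain ⟨x, y, hxy, h0⟩ : ∃ x y : ℝ, 0 < x ^ 2 + y ^ 2 ∧
      ∑ i, (x • b u + y • b v : EuclideanSpace ℝ (Fin K)) i = 0 := by
    have hs : ∀ x y : ℝ, ∑ i, (x • b u + y • b v : EuclideanSpace ℝ (Fin K)) i =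
        x * ∑ i, b u i + y * ∑ i, b v i := by
      intro x y
      simp [Finset.sum_add_distrib, Finset.mul_sum]
    by_cases hz : ∑ i, b u i = 0
    · exact ⟨1, 0, by norm_num, by rw [hs, hz]; ring⟩
    · refine ⟨-∑ i, b v i, ∑ i, b u i, ?_, by rw [hs]; ring⟩
      have := sq_pos_of_ne_zero hz
      positivity
  set f : EuclideanSpace ℝ (Fin K) := x • b u + y • b v
  have hin : ∀ i, inner ℝ (b i) f = (if i = u then x else 0) + if i = v then y else 0 := by
    intro i
    simp only [f, inner_add_right, inner_smul_right, b.inner_eq_ite]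
    simp
  have hn : ∑ i, f i ^ 2 = x ^ 2 + y ^ 2 := by
    have h1 : ∑ i, f i ^ 2 = ‖f‖ ^ 2 := by rw [EuclideanSpace.real_norm_sq_eq]
    rw [h1, ← b.sum_sq_norm_inner_right f, ← Finset.add_sum_erase _ _ (Finset.mem_univ u),
      ← Finset.add_sum_erase _ _ (Finset.mem_erase.2 ⟨huv.symm, Finset.mem_univ v⟩),
      Finset.sum_eq_zero]
    · simp [hin, huv, huv.symm]
    · intro i hi
      simp only [Finset.mem_erase] at hi
      simp [hin, hi.1, hi.2.1]
  have he : energy G f = ev u * x ^ 2 + ev v * y ^ 2 := by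
    rw [hE, ← Finset.add_sum_erase _ _ (Finset.mem_univ u),
      ← Finset.add_sum_erase _ _ (Finset.mem_erase.2 ⟨huv.symm, Finset.mem_univ v⟩),
      Finset.sum_eq_zero]
    · simp [hin, huv, huv.symm]
    · intro i hi
      simp only [Finset.mem_erase] at hi
      simp [hin, hi.1, hi.2.1]
  have := h f h0
  rw [hn, he, hv] at this
  by_contra! hcon
  nlinarith [sq_nonneg x, mul_le_mul_of_nonneg_right hu (sq_nonneg x),
    mul_lt_mul_of_pos_right hcon hxy]

/-- Combinations of a test function with constants bound `lambda2` from above. -/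
theorem lambda2_le {K : ℕ} (hK : 2 ≤ K) (G : SimpleGraph (Fin K)) {c : ℝ} (χ : Fin K → ℝ)
    (h : ∀ x y : ℝ, (x ≠ 0 ∨ y ≠ 0) → 0 < ∑ i, (x * χ i + y) ^ 2 ∧
      energy G (fun i => x * χ i + y) ≤ c * ∑ i, (x * χ i + y) ^ 2) :
    lambda2 G ≤ c := by
  classical
  obtain ⟨b, ev, u, v, huv, -, -, hi, hE⟩ := exists_eigenbasis hK G
  -- a combination that is orthogonal to the eigenvector `b u`
  obtain ⟨x, y, hxy, h0⟩ : ∃ x y : ℝ, (x ≠ 0 ∨ y ≠ 0) ∧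
      inner ℝ (b u) (WithLp.toLp 2 fun i => x * χ i + y) = 0 := by
    have hs : ∀ x y : ℝ, inner ℝ (b u) (WithLp.toLp 2 fun i => x * χ i + y) =
        x * ∑ i, χ i * b u i + y * ∑ i, b u i := by
      intro x y
      simp [PiLp.inner_apply, Finset.mul_sum, ← Finset.sum_add_distrib]
      refine Finset.sum_congr rfl fun i _ => ?_
      ring
    by_cases hz : ∑ i, b u i = 0
    · exact ⟨0, 1, by norm_num, by rw [hs, hz]; ring⟩
    · exact ⟨∑ i, b u i, -∑ i, χ i * b u i, Or.inl hz, by rw [hs]; ring⟩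
  obtain ⟨h1, h2⟩ := h x y hxy
  have h3 := hE (WithLp.toLp 2 fun i => x * χ i + y)
  have h4 : ∑ i, (x * χ i + y) ^ 2 =
      ∑ i, (inner ℝ (b i) (WithLp.toLp 2 fun i => x * χ i + y)) ^ 2 := by
    have := b.sum_sq_norm_inner_right (WithLp.toLp 2 fun i => x * χ i + y)
    rw [EuclideanSpace.real_norm_sq_eq] at this
    simp only [Real.norm_eq_abs, sq_abs] at this
    rw [this]
  have h5 : lambda2 G * ∑ i, (x * χ i + y) ^ 2 ≤ energy G (fun i => x * χ i + y) := by
    rw [h4, Finset.mul_sum]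
    refine le_trans (Finset.sum_le_sum fun i _ => ?_) (le_of_eq h3.symm)
    by_cases hiu : i = u
    · rw [hiu, h0]; simp
    · exact mul_le_mul_of_nonneg_right (hi i hiu) (sq_nonneg _)
  exact le_of_mul_le_mul_right (h5.trans h2) h1

/-! ### Double stars -/

/-- The parent of a node in the double star with root `0`: the root has the child `1` and all
nodes from `s + 2` on, and the nodes `2, …, s + 1` are the children of `1`. The root is made its
own parent. -/
def starParent (s i : ℕ) : ℕ := if 2 ≤ i ∧ i < s + 2 then 1 else 0

/-- The double star on `K` nodes, in which every node is adjacent to its parent. -/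
def doubleStar (K s : ℕ) : SimpleGraph (Fin K) where
  Adj i j := i ≠ j ∧ ((j : ℕ) = starParent s i ∨ (i : ℕ) = starParent s j)
  symm := ⟨fun _ _ h => ⟨h.1.symm, h.2.symm⟩⟩
  loopless := ⟨fun _ h => h.1 rfl⟩

theorem starParent_lt {K s : ℕ} (hK : 2 ≤ K) (i : ℕ) : starParent s i < K := by
  unfold starParent
  split_ifs <;> omega

theorem energy_doubleStar {K : ℕ} (s : ℕ) (hK : 2 ≤ K) (f : Fin K → ℝ) :
    energy (doubleStar K s) f =
      ∑ i : Fin K, (f i - f ⟨starParent s i, starParent_lt hK i⟩) ^ 2 := by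
  classical
  have h1 : ∀ i j : Fin K, (if (doubleStar K s).Adj i j then (f i - f j) ^ 2 else 0) =
      (if j = ⟨starParent s i, starParent_lt hK i⟩ then (f i - f j) ^ 2 else 0) +
      (if i = ⟨starParent s j, starParent_lt hK j⟩ then (f j - f i) ^ 2 else 0) := by
    intro i j
    by_cases hij : i = j
    · simp [hij]
    have hij' : (i : ℕ) ≠ j := fun h => hij (Fin.ext h)
    have ha : (doubleStar K s).Adj i j ↔
        ((j : ℕ) = starParent s i ∨ (i : ℕ) = starParent s j) := by
      simp [doubleStar, hij]
    have hx : ¬ ((j : ℕ) = starParent s i ∧ (i : ℕ) = starParent s j) := by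
      unfold starParent
      split_ifs <;> omega
    simp only [ha, Fin.ext_iff]
    by_cases h2 : (j : ℕ) = starParent s i
    · have h3 : ¬ (i : ℕ) = starParent s j := fun h => hx ⟨h2, h⟩
      simp [h3, if_pos h2]
    · by_cases h3 : (i : ℕ) = starParent s j
      · simp only [if_neg h2, if_pos h3, if_pos (Or.inr h3)]
        ring
      · simp [h2, h3]
  simp only [energy_eq_sum, h1, Finset.sum_add_distrib]
  conv_lhs =>
    enter [1, 2]
    rw [Finset.sum_comm]
  simp only [Finset.sum_ite_eq', Finset.mem_univ, if_true]
  ring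

theorem card_filter_starBranch {K s : ℕ} (hK : s + 2 ≤ K) :
    (Finset.univ.filter fun i : Fin K => 1 ≤ (i : ℕ) ∧ (i : ℕ) < s + 2).card = s + 1 := by
  have : (Finset.univ.filter fun i : Fin K => 1 ≤ (i : ℕ) ∧ (i : ℕ) < s + 2).map
      Fin.valEmbedding = Finset.Ico 1 (s + 2) := by
    ext i
    simp only [Finset.mem_map, Finset.mem_filter, Finset.mem_univ, true_and, Finset.mem_Ico,
      Fin.valEmbedding_apply]
    constructor
    · rintro ⟨a, h, rfl⟩
      exact h
    · intro h
      exact ⟨⟨i, by omega⟩, h, rfl⟩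
  rw [← Finset.card_map Fin.valEmbedding, this]
  simp

theorem le_lambda2_doubleStar {K s : ℕ} (hK : s + 2 ≤ K) :
    1 / (2 * s + 4 : ℝ) ≤ lambda2 (doubleStar K s) := by
  have hK2 : 2 ≤ K := by omega
  refine le_lambda2 hK2 _ fun f hf => ?_
  rw [one_div, inv_mul_le_iff₀ (by positivity), energy_doubleStar s hK2]
  set a := f ⟨0, by omega⟩ with ha
  set p : Fin K → Fin K := fun i => ⟨starParent s i, starParent_lt hK2 i⟩ with hp
  set one : Fin K := ⟨1, by omega⟩ with hone
  set D := (f one - a) ^ 2 with hD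
  have hD0 : 0 ≤ D := sq_nonneg _
  -- centring at the root instead of at the mean only increases the sum of squares
  have h1 : ∑ i, f i ^ 2 ≤ ∑ i, (f i - a) ^ 2 := by
    have : ∑ i, (f i - a) ^ 2 = ∑ i, f i ^ 2 - 2 * a * ∑ i, f i + K * a ^ 2 := by
      simp only [sub_sq, Finset.sum_add_distrib, Finset.sum_sub_distrib, Finset.mul_sum]
      simp only [Finset.sum_const, Finset.card_univ, Fintype.card_fin, nsmul_eq_mul]
      congr 2
      exact Finset.sum_congr rfl fun i _ => by ring
    rw [this, hf]
    have : 0 ≤ (K : ℝ) * a ^ 2 := by positivity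
    linarith
  have h2 : ∀ i : Fin K, (f i - a) ^ 2 ≤ 2 * (f i - f (p i)) ^ 2 +
      if 1 ≤ (i : ℕ) ∧ (i : ℕ) < s + 2 then 2 * D else 0 := by
    intro i
    by_cases h : 2 ≤ (i : ℕ) ∧ (i : ℕ) < s + 2
    · have hpi : p i = one := Fin.ext (by simp [hp, starParent, h, hone])
      rw [hpi, if_pos ⟨by omega, h.2⟩, hD]
      nlinarith [sq_nonneg (f i - f one - (f one - a))]
    · have hpi : f (p i) = a := by
        rw [ha]
        congr 1
        exact Fin.ext (by simp [hp, starParent, h])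
      rw [hpi]
      split_ifs <;> nlinarith [sq_nonneg (f i - a)]
  have h3 : D ≤ ∑ i, (f i - f (p i)) ^ 2 := by
    have hpi : f (p one) = a := by
      rw [ha]
      congr 1
    calc D = (f one - f (p one)) ^ 2 := by rw [hpi]
      _ ≤ _ := Finset.single_le_sum (f := fun i => (f i - f (p i)) ^ 2)
        (fun i _ => sq_nonneg _) (Finset.mem_univ one)
  calc ∑ i, f i ^ 2 ≤ ∑ i, (f i - a) ^ 2 := h1
    _ ≤ ∑ i : Fin K, (2 * (f i - f (p i)) ^ 2 +
      if 1 ≤ (i : ℕ) ∧ (i : ℕ) < s + 2 then 2 * D else 0) := Finset.sum_le_sum fun i _ => h2 i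
    _ = 2 * ∑ i, (f i - f (p i)) ^ 2 + (s + 1) * (2 * D) := by
      rw [Finset.sum_add_distrib, ← Finset.mul_sum, ← Finset.sum_filter, Finset.sum_const,
        card_filter_starBranch hK, nsmul_eq_mul]
      push_cast
      ring
    _ ≤ _ := by nlinarith

theorem lambda2_doubleStar_le {K s : ℕ} (hK : 2 * (s + 1) ≤ K) :
    lambda2 (doubleStar K s) ≤ 2 / (s + 1 : ℝ) := by
  classical
  have hK2 : 2 ≤ K := by omega
  -- the test function is the indicator of the branch at the node `1`
  set χ : Fin K → ℝ := fun i => if 1 ≤ (i : ℕ) ∧ (i : ℕ) < s + 2 then 1 else 0 with hχ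
  refine lambda2_le hK2 _ χ fun x y hxy => ?_
  have hs0 : (0 : ℝ) < s + 1 := by positivity
  have hKs : 2 * (s + 1 : ℝ) ≤ K := by exact_mod_cast hK
  have hnorm : ∑ i, (x * χ i + y) ^ 2 = (s + 1) * (x + y) ^ 2 + (K - (s + 1)) * y ^ 2 := by
    have : ∀ i, (x * χ i + y) ^ 2 =
        (if 1 ≤ (i : ℕ) ∧ (i : ℕ) < s + 2 then (x + y) ^ 2 - y ^ 2 else 0) + y ^ 2 := by
      intro i
      simp only [hχ]
      split_ifs <;> ring
    simp only [this, Finset.sum_add_distrib]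
    rw [← Finset.sum_filter, Finset.sum_const, card_filter_starBranch (by omega)]
    simp
    ring
  have henergy : energy (doubleStar K s) (fun i => x * χ i + y) ≤ x ^ 2 := by
    rw [energy_doubleStar s hK2, Finset.sum_eq_single (⟨1, by omega⟩ : Fin K)]
    · simp [hχ, starParent]
    · intro i _ hi
      have hi' : (i : ℕ) ≠ 1 := fun h => hi (Fin.ext h)
      simp only [hχ, starParent]
      by_cases h : 2 ≤ (i : ℕ) ∧ (i : ℕ) < s + 2
      · have : 1 ≤ (i : ℕ) ∧ (i : ℕ) < s + 2 := ⟨by omega, h.2⟩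
        simp [h, this]
      · have : ¬ (1 ≤ (i : ℕ) ∧ (i : ℕ) < s + 2) := by omega
        simp [h, this]
    · simp
  have hlow : (s + 1) * ((x + y) ^ 2 + y ^ 2) ≤ ∑ i, (x * χ i + y) ^ 2 := by
    rw [hnorm]
    nlinarith [sq_nonneg y]
  have hsq : x ^ 2 ≤ 2 * ((x + y) ^ 2 + y ^ 2) := by nlinarith [sq_nonneg (x + 2 * y)]
  refine ⟨lt_of_lt_of_le (mul_pos hs0 ?_) hlow, henergy.trans ?_⟩
  · rcases eq_or_ne y 0 with rfl | hy
    · have := sq_pos_of_ne_zero (hxy.resolve_right (by simp))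
      simpa using this
    · have := sq_pos_of_ne_zero hy
      positivity
  · rw [div_mul_eq_mul_div, le_div_iff₀ hs0]
    nlinarith

/-! ### From the average to a single environment -/

/-- The history takes finitely many values, on measurable events. -/
theorem Algorithm.exists_finset_history (A : Algorithm Ω K) (ℓ : ℕ → Fin K → ℝ) (t : ℕ) :
    ∃ F : Set (List (Observation K)), F.Finite ∧ (∀ ω, A.history ℓ ω t ∈ F) ∧
      ∀ h, MeasurableSet {ω | A.history ℓ ω t = h} := by
  induction t with
  | zero =>
    refine ⟨{[]}, Set.finite_singleton _, fun ω => rfl, fun h => ?_⟩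
    by_cases hh : [] = h
    · simp [history, hh]
    · simp [history, hh]
  | succ t ih =>
    obtain ⟨F, hF, hmem, hmeas⟩ := ih
    let g : List (Observation K) × Fin K → List (Observation K) := fun p =>
      p.1 ++ [{ arm := p.2, loss := ℓ t p.2, anchor := ⨅ i, ℓ t i }]
    have hg : ∀ ω, A.history ℓ ω (t + 1) =
        g (A.history ℓ ω t, A.choose (A.history ℓ ω t) ω) := fun ω => rfl
    have hfin : (F ×ˢ (Set.univ : Set (Fin K))).Finite := hF.prod Set.finite_univ
    refine ⟨g '' (F ×ˢ Set.univ), hfin.image g, fun ω => ?_, fun h => ?_⟩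
    · rw [hg]
      exact ⟨_, ⟨hmem ω, Set.mem_univ _⟩, rfl⟩
    · have : {ω | A.history ℓ ω (t + 1) = h} =
          ⋃ p ∈ {p | p ∈ F ×ˢ (Set.univ : Set (Fin K)) ∧ g p = h},
            {ω | A.history ℓ ω t = p.1} ∩ {ω | A.choose p.1 ω = p.2} := by
        ext ω
        simp only [Set.mem_ofPred_eq, Set.mem_iUnion, Set.mem_inter_iff, exists_prop, hg]
        constructor
        · intro hω
          exact ⟨_, ⟨⟨hmem ω, Set.mem_univ _⟩, hω⟩, rfl, rfl⟩
        · rintro ⟨⟨l, k⟩, ⟨-, hp⟩, h1, h2⟩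
          simp only at h1 h2
          rw [h1, h2, hp]
      rw [this]
      refine Set.Finite.measurableSet_biUnion (hfin.subset fun p hp => hp.1) fun p _ => ?_
      exact (hmeas p.1).inter (A.measurable_choose p.1 (measurableSet_singleton p.2))

theorem Algorithm.measurable_arm (A : Algorithm Ω K) (ℓ : ℕ → Fin K → ℝ) (t : ℕ) :
    Measurable (A.arm ℓ t) := by
  obtain ⟨F, hF, hmem, hmeas⟩ := A.exists_finset_history ℓ t
  refine measurable_to_countable' fun k => ?_
  have : A.arm ℓ t ⁻¹' {k} =
      ⋃ h ∈ F, {ω | A.history ℓ ω t = h} ∩ {ω | A.choose h ω = k} := by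
    ext ω
    simp only [Set.mem_preimage, Set.mem_singleton_iff, Set.mem_iUnion, Set.mem_inter_iff,
      Set.mem_ofPred_eq, exists_prop, arm]
    constructor
    · intro hω
      exact ⟨_, hmem ω, rfl, hω⟩
    · rintro ⟨h, -, h1, h2⟩
      rw [h1, h2]
  rw [this]
  exact hF.measurableSet_biUnion fun h _ =>
    (hmeas h).inter (A.measurable_choose h (measurableSet_singleton k))

theorem Algorithm.integrable_sum_loss (A : Algorithm Ω K) (μ : Measure Ω) [IsProbabilityMeasure μ]
    (ℓ : ℕ → Fin K → ℝ) (T : ℕ) :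
    Integrable (fun ω => ∑ t ∈ Finset.range T, ℓ t (A.arm ℓ t ω)) μ := by
  refine integrable_finsetSum _ fun t _ => ?_
  refine Integrable.of_bound (C := ∑ j, |ℓ t j|)
    ((Measurable.of_discrete (f := ℓ t)).comp (A.measurable_arm ℓ t)).aestronglyMeasurable
    (Filter.Eventually.of_forall fun ω => ?_)
  exact Finset.single_le_sum (f := fun j => |ℓ t j|) (fun _ _ => abs_nonneg _)
    (Finset.mem_univ (A.arm ℓ t ω))

theorem Algorithm.integral_le_expectedRegret (A : Algorithm Ω K) (μ : Measure Ω)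
    [IsProbabilityMeasure μ] (ℓ : ℕ → Fin K → ℝ) (T : ℕ) (i : Fin K) :
    ∫ ω, ∑ t ∈ Finset.range T, (ℓ t (A.arm ℓ t ω) - ℓ t i) ∂μ ≤ A.expectedRegret μ ℓ T := by
  simp only [Finset.sum_sub_distrib]
  rw [integral_sub (A.integrable_sum_loss μ ℓ T) (integrable_const _), integral_const]
  simp only [probReal_univ, one_smul, expectedRegret]
  have := ciInf_le (Set.finite_range fun i => ∑ t ∈ Finset.range T, ℓ t i).bddBelow i
  exact sub_le_sub_left this _

/-- Against every randomized learner, some realization of the hard environments forces a regret of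
order `√(m T)`. -/
theorem Algorithm.exists_regret_ge (A : Algorithm Ω K) (μ : Measure Ω) [IsProbabilityMeasure μ]
    {σ : ℝ} (hσ : 0 ≤ σ) {T : ℕ} {d h : Fin K} (hd : h ≠ d) (I : Finset (Fin K))
    (hI : ∀ i ∈ I, h ≠ i ∧ i ≠ d) (hI2 : 2 ≤ I.card) (hIT : I.card ≤ T) :
    ∃ i ∈ I, ∃ e : ℕ → Bool × Bool,
      σ * √((I.card : ℝ) * T) / 64 ≤ A.expectedRegret μ (bitLoss σ (hardBit d i) e) T := by
  set ε := √((I.card : ℝ) / T) / 16 with hε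
  set B := σ * √((I.card : ℝ) * T) / 64 with hB
  have hm2 : (2 : ℝ) ≤ I.card := by exact_mod_cast hI2
  have hmT : (I.card : ℝ) ≤ T := by exact_mod_cast hIT
  have hT : (0 : ℝ) < T := by linarith
  have hε0 : 0 < ε := by
    have : (0 : ℝ) < I.card := by linarith
    positivity
  have hε1 : 2 * ε < 1 := by
    have : √((I.card : ℝ) / T) ≤ 1 := by
      rw [Real.sqrt_le_iff, one_pow, div_le_one hT]
      exact ⟨zero_le_one, hmT⟩
    rw [hε]
    linarith
  set R : Fin K → (Fin T → Bool × Bool) → Ω → ℝ := fun i e ω =>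
    ∑ t ∈ Finset.range T, (bitLoss σ (hardBit d i) (extend e) t
        (A.arm (bitLoss σ (hardBit d i) (extend e)) t ω) -
        bitLoss σ (hardBit d i) (extend e) t i) with hR
  have hRint : ∀ i e, Integrable (R i e) μ := by
    intro i e
    simp only [hR, Finset.sum_sub_distrib]
    exact (A.integrable_sum_loss μ _ T).sub (integrable_const _)
  have hone : ∑ e : Fin T → Bool × Bool, ∏ t, hardWeight ε (e t) = 1 := by
    rw [sum_prod_weight (fun _ => hardWeight ε)]
    simp [sum_hardWeight]
  have hsumint : ∀ i, Integrable (fun ω => ∑ e, (∏ t, hardWeight ε (e t)) * R i e ω) μ :=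
    fun i => integrable_finsetSum _ fun e _ => (hRint i e).const_mul _
  have hint : (I.card : ℝ) * B ≤
      ∑ i ∈ I, ∑ e : Fin T → Bool × Bool, (∏ t, hardWeight ε (e t)) * ∫ ω, R i e ω ∂μ := by
    have h1 : ∑ i ∈ I, ∑ e : Fin T → Bool × Bool, (∏ t, hardWeight ε (e t)) * ∫ ω, R i e ω ∂μ =
        ∫ ω, ∑ i ∈ I, ∑ e : Fin T → Bool × Bool, (∏ t, hardWeight ε (e t)) * R i e ω ∂μ := by
      rw [integral_finsetSum _ fun i _ => hsumint i]
      refine Finset.sum_congr rfl fun i _ => ?_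
      rw [integral_finsetSum _ fun e _ => (hRint i e).const_mul _]
      exact Finset.sum_congr rfl fun e _ => (integral_const_mul _ _).symm
    rw [h1]
    calc (I.card : ℝ) * B = ∫ _ω, (I.card : ℝ) * B ∂μ := by simp
      _ ≤ _ := integral_mono (integrable_const _) (integrable_finsetSum _ fun i _ => hsumint i)
        fun ω => A.sum_sum_regret_ge ω hσ hd I hI hI2 hIT hε
  have hne : I.Nonempty := Finset.card_pos.1 (by omega)
  -- the weights are positive, so at least one environment attains the average
  obtain ⟨i, hi, h2⟩ := Finset.exists_le_of_sum_le hne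
    (f := fun _ => ∑ e : Fin T → Bool × Bool, (∏ t, hardWeight ε (e t)) * B)
    (g := fun i => ∑ e : Fin T → Bool × Bool, (∏ t, hardWeight ε (e t)) * ∫ ω, R i e ω ∂μ)
    (by
      rw [← Finset.sum_mul, hone, one_mul, Finset.sum_const, nsmul_eq_mul]
      exact hint)
  obtain ⟨e, -, h3⟩ := Finset.exists_le_of_sum_le Finset.univ_nonempty h2
  refine ⟨i, hi, extend e, ?_⟩
  have h4 : 0 < ∏ t, hardWeight ε (e t) := Finset.prod_pos fun t _ => hardWeight_pos hε0 hε1 _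
  exact (le_of_mul_le_mul_left h3 h4).trans (A.integral_le_expectedRegret μ _ T i)

/-! ### The lower bound on double stars -/

theorem bitLoss_mem {S : Type*} {σ : ℝ} (h0 : 0 ≤ σ) (h1 : σ ≤ 1) (bit : S → Fin K → Bool)
    (e : ℕ → S) (t : ℕ) (j : Fin K) : 0 ≤ bitLoss σ bit e t j ∧ bitLoss σ bit e t j ≤ 1 := by
  unfold bitLoss
  split_ifs <;> constructor <;> linarith

/-- All arms but two leaves at the root have the same loss, and each of the two leaves has a single
edge. -/
theorem energy_bitLoss_le {s : ℕ} (hK : 2 ≤ K) (σ : ℝ) {d i : Fin K} (hd : s + 2 ≤ (d : ℕ))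
    (hi : s + 2 ≤ (i : ℕ)) (hid : i ≠ d) (e : ℕ → Bool × Bool) (t : ℕ) :
    energy (doubleStar K s) (bitLoss σ (hardBit d i) e t) ≤ 2 * σ ^ 2 := by
  classical
  set Z : ℝ := if (e t).1 then 1 else 0 with hZ
  have hparent : ∀ j : Fin K,
      (if hardBit d i (e t) ⟨starParent s j, starParent_lt hK j⟩ then (1 : ℝ) else 0) = Z := by
    intro j
    have h1 : starParent s j < s + 2 := by unfold starParent; split_ifs <;> omega
    have h2 : (⟨starParent s j, starParent_lt hK j⟩ : Fin K) ≠ d := fun h => by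
      rw [← h] at hd
      simp only at hd
      omega
    have h3 : (⟨starParent s j, starParent_lt hK j⟩ : Fin K) ≠ i := fun h => by
      rw [← h] at hi
      simp only at hi
      omega
    simp [hardBit, h2, h3, hZ]
  have hterm : ∀ j : Fin K, ((if hardBit d i (e t) j then (1 : ℝ) else 0) -
      (if hardBit d i (e t) ⟨starParent s j, starParent_lt hK j⟩ then (1 : ℝ) else 0)) ^ 2 ≤
      (if j = d then 1 else 0) + if j = i then 1 else 0 := by
    intro j
    rw [hparent j, hZ]
    by_cases h1 : j = d
    · have h2 : j ≠ i := fun h => hid (h.symm.trans h1)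
      simp only [h1, if_true, hardBit]
      split_ifs <;> norm_num
    · by_cases h2 : j = i
      · simp only [hardBit, if_neg h1, if_pos h2]
        split_ifs <;> norm_num
      · simp [hardBit, h1, h2]
  have : energy (doubleStar K s) (bitLoss σ (hardBit d i) e t) = σ ^ 2 *
      energy (doubleStar K s) (fun j => if hardBit d i (e t) j then 1 else 0) :=
    energy_const_mul _ _ _
  rw [this, energy_doubleStar s hK, mul_comm]
  refine mul_le_mul_of_nonneg_right ?_ (sq_nonneg σ)
  refine (Finset.sum_le_sum fun j _ => hterm j).trans ?_
  rw [Finset.sum_add_distrib]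
  simp
  norm_num

/-- A set of `m` leaves at the root other than the leaf `s + 2`. -/
theorem exists_leaves {K s m : ℕ} (h : s + 3 + m ≤ K) :
    ∃ I : Finset (Fin K), I.card = m ∧ ∀ i ∈ I, s + 3 ≤ (i : ℕ) := by
  refine ⟨Finset.univ.image fun j : Fin m => (⟨s + 3 + j, by omega⟩ : Fin K), ?_, fun i hi => ?_⟩
  · rw [Finset.card_image_of_injective _ fun a b hab => ?_, Finset.card_univ, Fintype.card_fin]
    simp only [Fin.mk.injEq] at hab
    exact Fin.ext (by omega)
  · simp only [Finset.mem_image, Finset.mem_univ, true_and] at hi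
    obtain ⟨j, rfl⟩ := hi
    simp only
    omega

/-- With `m` about `min K (max 2 (C ^ 2) / lam)` competing arms and losses of size
`min 1 (C / √2)`, the bound of the hard environments is of the required order. -/
theorem min_le_scaled_sqrt {lam C L k m : ℝ} (hlam : 0 < lam) (hC : 0 < C)
    (hL : lam / 8 ≤ L) (hk : 4 / lam ≤ k) (hm : min (k / 2) (max 2 (C ^ 2) / lam) ≤ m) :
    min √k (C / √L) ≤ 4 * (min 1 (C / √2) * √m) := by
  have hL0 : 0 < L := by linarith [div_pos hlam (show (0 : ℝ) < 8 by norm_num)]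
  have hk0 : 0 < k := lt_of_lt_of_le (by positivity) hk
  have h2 : 0 < √(2 : ℝ) := by positivity
  have hCL : C / √L ≤ √(8 * (C ^ 2 / lam)) := by
    apply Real.le_sqrt_of_sq_le
    rw [div_pow, Real.sq_sqrt hL0.le, div_le_iff₀ hL0]
    have : 8 * (C ^ 2 / lam) * L = C ^ 2 * (8 * L / lam) := by ring
    rw [this]
    have h1 : 1 ≤ 8 * L / lam := by
      rw [le_div_iff₀ hlam]
      linarith
    nlinarith [sq_nonneg C]
  have key : ∀ a : ℝ, 0 ≤ a → ∀ b : ℝ, a ≤ 16 * b → √a ≤ 4 * √b := by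
    intro a ha b hab
    rw [show (4 : ℝ) = √16 by rw [show (16 : ℝ) = 4 ^ 2 by norm_num, Real.sqrt_sq (by norm_num)],
      ← Real.sqrt_mul (by norm_num)]
    exact Real.sqrt_le_sqrt hab
  rcases le_total 2 (C ^ 2) with hc | hc
  · have hs : 1 ≤ C / √2 := by
      rw [le_div_iff₀ h2, one_mul]
      exact Real.sqrt_le_iff.2 ⟨hC.le, hc⟩
    rw [min_eq_left hs, one_mul]
    rw [max_eq_right hc] at hm
    rcases min_le_iff.1 hm with h | h
    · exact (min_le_left _ _).trans (key k hk0.le m (by linarith))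
    · have : 0 ≤ C ^ 2 / lam := by positivity
      exact (min_le_right _ _).trans (hCL.trans (key _ (by positivity) m (by linarith)))
  · have hs : C / √2 ≤ 1 := by
      rw [div_le_iff₀ h2, one_mul]
      exact Real.le_sqrt_of_sq_le hc
    rw [min_eq_right hs]
    rw [max_eq_left hc, min_eq_right (by
      rw [le_div_iff₀ (by norm_num)]
      linarith [show 2 / lam * 2 = 4 / lam by ring])] at hm
    refine (min_le_right _ _).trans (hCL.trans ?_)
    have : C / √2 * √m = √(C ^ 2 / 2 * m) := by
      rw [Real.sqrt_mul (by positivity), Real.sqrt_div' _ (by norm_num), Real.sqrt_sq hC.le]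
    rw [this]
    refine key _ (by positivity) _ ?_
    have h3 : C ^ 2 * (2 / lam) ≤ C ^ 2 * m := mul_le_mul_of_nonneg_left hm (sq_nonneg C)
    have h4 : C ^ 2 * (2 / lam) = 2 * (C ^ 2 / lam) := by ring
    have h5 : 0 ≤ C ^ 2 / lam := by positivity
    linarith


end SmoothBandit

theorem theorem4 :
    ∃ c₁ c₂ c : ℝ, 0 < c₁ ∧ 0 < c₂ ∧ 0 < c ∧
      ∀ lam : ℝ, 0 < lam → lam ≤ 1 → ∃ K₀ : ℕ,
      ∀ C : ℝ, 0 < C → ∃ T₀ : ℕ,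
      ∀ K : ℕ, K₀ ≤ K → ∀ T : ℕ, T₀ ≤ T →
      ∀ (Ω : Type*) [MeasurableSpace Ω] (μ : Measure Ω) [IsProbabilityMeasure μ]
        (A : SmoothBandit.Algorithm Ω K),
      ∃ (G : SimpleGraph (Fin K)) (ℓ : ℕ → Fin K → ℝ),
        c₁ * lam ≤ SmoothBandit.lambda2 G ∧ SmoothBandit.lambda2 G ≤ c₂ * lam ∧
        (∀ t < T, ∀ i, 0 ≤ ℓ t i ∧ ℓ t i ≤ 1) ∧
        (∀ t < T, ℓ t ⬝ᵥ (SmoothBandit.laplacian G).mulVec (ℓ t) ≤ C ^ 2) ∧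
        c * (min √(K : ℝ) (C / √(SmoothBandit.lambda2 G)) * √(T : ℝ)) ≤
          A.expectedRegret μ ℓ T := by
  refine ⟨1 / 8, 2, 1 / 256, by norm_num, by norm_num, by norm_num, fun lam hlam hlam1 => ?_⟩
  set s : ℕ := ⌈1 / lam⌉₊ with hs
  have hs1 : 1 / lam ≤ s := Nat.le_ceil _
  have hs2 : (s : ℝ) < 1 / lam + 1 := Nat.ceil_lt_add_one (by positivity)
  have hlam' : 1 ≤ 1 / lam := by rw [le_div_iff₀ hlam]; linarith
  -- `4 * (s + 3)` nodes leave room for `K / 2` competing leaves at the root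
  refine ⟨4 * (s + 3), fun C hC => ?_⟩
  set M : ℝ := max 2 (C ^ 2) / lam with hM
  have hM2 : 2 ≤ M := by
    rw [hM, le_div_iff₀ hlam]
    linarith [le_max_left 2 (C ^ 2)]
  refine ⟨⌈M⌉₊, fun K hK T hT Ω _ μ _ A => ?_⟩
  set σ : ℝ := min 1 (C / √2) with hσ
  have hσ0 : 0 ≤ σ := le_min zero_le_one (by positivity)
  set m : ℕ := min (K - (s + 3)) ⌈M⌉₊ with hm
  have hM2' : 2 ≤ ⌈M⌉₊ := by
    have : (2 : ℝ) ≤ ⌈M⌉₊ := hM2.trans (Nat.le_ceil M)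
    exact_mod_cast this
  have hm2 : 2 ≤ m := le_min (by omega) hM2'
  have hmK : s + 3 + m ≤ K := by
    have : m ≤ K - (s + 3) := min_le_left _ _
    omega
  have hmT : m ≤ T := (min_le_right _ _).trans hT
  obtain ⟨I, hIc, hI⟩ := SmoothBandit.exists_leaves hmK
  -- `d` is the first leaf at the root; the root itself is an arm other than `d` and the best arm
  let d : Fin K := ⟨s + 2, by omega⟩
  obtain ⟨i, hi, e, hreg⟩ := A.exists_regret_ge μ hσ0 (T := T)
    (d := d) (h := ⟨0, by omega⟩) (by simp [d, Fin.ext_iff]) I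
    (fun i hi => by
      have := hI i hi
      constructor <;> intro h <;> simp only [d, Fin.ext_iff] at h <;> omega)
    (by rwa [hIc]) (by rwa [hIc])
  have hlow : 1 / 8 * lam ≤ SmoothBandit.lambda2 (SmoothBandit.doubleStar K s) := by
    refine le_trans ?_ (SmoothBandit.le_lambda2_doubleStar (K := K) (s := s) (by omega))
    rw [le_div_iff₀ (by positivity)]
    have h1 : 2 * (s : ℝ) + 4 ≤ 8 * (1 / lam) := by linarith
    calc 1 / 8 * lam * (2 * s + 4) ≤ 1 / 8 * lam * (8 * (1 / lam)) :=
          mul_le_mul_of_nonneg_left h1 (by positivity)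
      _ = 1 := by field_simp
  have hup : SmoothBandit.lambda2 (SmoothBandit.doubleStar K s) ≤ 2 * lam := by
    refine (SmoothBandit.lambda2_doubleStar_le (K := K) (s := s) (by omega)).trans ?_
    rw [div_le_iff₀ (by positivity)]
    have h1 : lam * (1 / lam) ≤ lam * (s + 1) :=
      mul_le_mul_of_nonneg_left (by linarith) hlam.le
    rw [mul_one_div_cancel hlam.ne'] at h1
    linarith
  refine ⟨SmoothBandit.doubleStar K s, SmoothBandit.bitLoss σ (SmoothBandit.hardBit d i) e,
    hlow, hup,
    fun t _ j => SmoothBandit.bitLoss_mem hσ0 (min_le_left _ _) _ e t j, fun t _ => ?_, ?_⟩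
  · refine (SmoothBandit.energy_bitLoss_le (K := K) (s := s) (by omega) σ le_rfl
      (by have := hI i hi; omega) (fun h => ?_) e t).trans ?_
    · have := hI i hi
      simp only [h, d] at this
      omega
    · have h1 : σ ^ 2 ≤ (C / √2) ^ 2 := pow_le_pow_left₀ hσ0 (min_le_right _ _) 2
      rw [div_pow, Real.sq_sqrt (by norm_num)] at h1
      linarith
  · refine le_trans ?_ hreg
    rw [hIc, Real.sqrt_mul (Nat.cast_nonneg m)]
    have hKs : 4 * ((s : ℝ) + 3) ≤ K := by exact_mod_cast hK
    have hmin : min ((K : ℝ) / 2) M ≤ m := by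
      rw [hm, Nat.cast_min, Nat.cast_sub (by omega)]
      push_cast
      exact min_le_min (by linarith) (Nat.le_ceil M)
    have hk4 : 4 / lam ≤ (K : ℝ) := by
      rw [show 4 / lam = 4 * (1 / lam) by ring]
      linarith
    have h2 := SmoothBandit.min_le_scaled_sqrt hlam hC
      (L := SmoothBandit.lambda2 (SmoothBandit.doubleStar K s)) (by linarith) hk4 hmin
    have h3 := mul_le_mul_of_nonneg_right h2 (Real.sqrt_nonneg (T : ℝ))
    rw [← hσ] at h3
    linarith
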